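/- For a braid $\beta\in B_n$ ($n\ge 1$) with exponent sum (writhe) $w=w(\beta)$, let $P_{\widehat\beta}(v,z)$ be the Homflypt polynomial of its closure, normalized by $P_{\text{unknot}}=1$ and $P_{D_+}=vz\,P_{D_0}+v^2P_{D_-}$. Define the Laurent coefficient polynomials $h_j=h_{j,\widehat\beta}\in\mathbb Z[z,z^{-1}]$ by $$P_{\widehat\beta}(v,z)=v^{\,w-n+1}\sum_{j=0}^{n-1}h_j(z)\,v^{2j},$$ let $\nabla_{\widehat\beta}(z)=P_{\widehat\beta}(1,z)$ be the Conway polynomial, and for $p\in\mathbb Z$ let $C_p(z)$ be the Conway polynomial of the closure of $\sigma_1^p\in B_2$. A function of braids is a link invariant if it takes equal values on braids whose closures are the same oriented link, i.e. if it is invariant under conjugation and under positive and negative Markov stabilization. **Theorem.** Let $A_0,A_1,A_2,\dots\in\mathbb Z[z,z^{-1}]$ and let $\Omega_{n,\beta}=\sum_{j=0}^{n-1}A_jh_{j,\widehat\beta}$ for all $n\ge1$ and all $\beta\in B_n$. Then $\Omega$ is a link invariant if and only if it is invariant under negative Markov stabilization $\beta\mapsto\beta\sigma_n^{-1}\in B_{n+1}$,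 and: (i) If $\Omega$ is a link invariant, then $A_j=A_0$ for all $j$, and $\Omega_{n,\beta}=A_0\nabla_{\widehat\beta}$ for all $n,\beta$. (ii) If $\Omega_{n,\beta}$ depends only on $w-n$, then $\Omega$ and the $A_j$ are linear combinations, with the same weights, of the two sides of the relations $\sum_j C_{2j-3}h_j=C_{4+w-n}$ and $\sum_jC_{2j-1}h_j=C_{2+w-n}$: there are $a_1,a_2\in\mathbb Z[z,z^{-1}]$ with $$A_j=a_1C_{2j-3}+a_2C_{2j-1}\ (j\ge0),\qquad \Omega_{n,\beta}=a_1C_{4+w-n}+a_2C_{2+w-n}\ \text{ for all }n,\beta.$$ Moreover $$A_j=\tfrac{A_0}{z}\,C_{2-2j}-\tfrac{A_1}{z}\,C_{-2j}\ (j\ge0),\qquad \Omega_{n,\beta}=\tfrac{A_0}{z}\,C_{w-n+3}-\tfrac{A_1}{z}\,C_{w-n+1}\ \text{ for all }n,\beta.$$ (iii) Otherwise, that is, if $\Omega$ is not a link invariant and is not a function of $w-n$ alone, then for every family of parameters (functions of braids) whose values determine $\Omega$, some parameter in the family is not a link invariant, and some parameter in the family is not a function of $w-n$ alone. -/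

import Mathlib

set_option linter.all false

namespace BraidLink

noncomputable section

section Hecke
variable {R : Type} [CommRing R] (z : R)

/-- The free module with basis `T_w`, `w` a permutation of `ℕ`; it is the left regular module of the
Iwahori-Hecke algebra on infinitely many strands. The basis vector `T_w` is `Finsupp.single w 1`. -/
abbrev HeckeModule (R : Type) [CommRing R] : Type := Equiv.Perm ℕ →₀ R

/-- Left multiplication by the generator `g_i = T_{s_i}`, `s_i = (i, i+1)`, of the Hecke algebra with
`g_i ^ 2 = z g_i + 1`: `g_i T_w` is `T_{s_i w}` if the length goes up, and `T_{s_i w} + z T_w`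
otherwise. -/
def heckeGen (i : ℕ) : Module.End R (HeckeModule R) :=
  Finsupp.linearCombination R fun w : Equiv.Perm ℕ =>
    Finsupp.single (Equiv.swap i (i + 1) * w) (1 : R) +
      if w⁻¹ (i + 1) < w⁻¹ i then Finsupp.single w z else 0

/-- Right multiplication by `g_i`. -/
def heckeGenRight (i : ℕ) : Module.End R (HeckeModule R) :=
  Finsupp.linearCombination R fun w : Equiv.Perm ℕ =>
    Finsupp.single (w * Equiv.swap i (i + 1)) (1 : R) +
      if w (i + 1) < w i then Finsupp.single w z else 0

theorem heckeGen_single (i : ℕ) (w : Equiv.Perm ℕ) (c : R) :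
    heckeGen z i (Finsupp.single w c) = Finsupp.single (Equiv.swap i (i + 1) * w) c +
      if w⁻¹ (i + 1) < w⁻¹ i then Finsupp.single w (c * z) else 0 := by
  simp only [heckeGen, Finsupp.linearCombination_single, smul_add, smul_ite, smul_zero,
    Finsupp.smul_single, smul_eq_mul, mul_one]

theorem heckeGenRight_single (i : ℕ) (w : Equiv.Perm ℕ) (c : R) :
    heckeGenRight z i (Finsupp.single w c) = Finsupp.single (w * Equiv.swap i (i + 1)) c +
      if w (i + 1) < w i then Finsupp.single w (c * z) else 0 := by
  simp only [heckeGenRight, Finsupp.linearCombination_single, smul_add, smul_ite, smul_zero,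
    Finsupp.smul_single, smul_eq_mul, mul_one]

theorem heckeGen_sq (i : ℕ) :
    heckeGen z i * heckeGen z i = algebraMap R _ z * heckeGen z i + 1 := by
  refine Finsupp.lhom_ext fun w c => ?_
  have h : w⁻¹ (i + 1) ≠ w⁻¹ i := fun h => by simpa using (w⁻¹).injective h
  have hs : Equiv.swap i (i + 1) * (Equiv.swap i (i + 1) * w) = w := by simp
  simp only [Module.End.mul_apply, LinearMap.add_apply, Module.algebraMap_end_apply,
    Module.End.one_apply, heckeGen_single, map_add, hs, mul_inv_rev, Equiv.Perm.mul_apply,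
    Equiv.swap_inv, Equiv.swap_apply_left, Equiv.swap_apply_right, smul_add, Finsupp.smul_single,
    smul_eq_mul]
  rcases lt_or_gt_of_ne h with h | h
  · simp only [h, h.not_gt, if_true, if_false, heckeGen_single, Finsupp.smul_single, smul_eq_mul,
      mul_comm z]
    abel
  · simp only [h, h.not_gt, if_true, if_false, map_zero, smul_zero, mul_comm z]
    abel

theorem heckeGen_far (i j : ℕ) (hij : i + 2 ≤ j) :
    heckeGen z i * heckeGen z j = heckeGen z j * heckeGen z i := by
  refine Finsupp.lhom_ext fun w c => ?_
  have hc : Equiv.swap i (i+1) * Equiv.swap j (j+1) = Equiv.swap j (j+1) * Equiv.swap i (i+1) := by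
    ext k; simp only [Equiv.Perm.mul_apply, Equiv.swap_apply_def]; split_ifs <;> omega
  have e1 : Equiv.swap i (i+1) j = j := Equiv.swap_apply_of_ne_of_ne (by omega) (by omega)
  have e2 : Equiv.swap i (i+1) (j+1) = j+1 := Equiv.swap_apply_of_ne_of_ne (by omega) (by omega)
  have e3 : Equiv.swap j (j+1) i = i := Equiv.swap_apply_of_ne_of_ne (by omega) (by omega)
  have e4 : Equiv.swap j (j+1) (i+1) = i+1 := Equiv.swap_apply_of_ne_of_ne (by omega) (by omega)
  simp only [Module.End.mul_apply, heckeGen_single, map_add, apply_ite (heckeGen z _), map_zero,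
    mul_inv_rev, Equiv.Perm.mul_apply, Equiv.swap_inv, e1, e2, e3, e4, ← mul_assoc, hc]
  split_ifs <;> simp <;> abel

theorem heckeGen_braid (i : ℕ) :
    heckeGen z i * heckeGen z (i + 1) * heckeGen z i =
      heckeGen z (i + 1) * heckeGen z i * heckeGen z (i + 1) := by
  refine Finsupp.lhom_ext fun w c => ?_
  have hc : Equiv.swap i (i+1) * Equiv.swap (i+1) (i+1+1) * Equiv.swap i (i+1) =
      Equiv.swap (i+1) (i+1+1) * Equiv.swap i (i+1) * Equiv.swap (i+1) (i+1+1) := by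
    ext k; simp only [Equiv.Perm.mul_apply, Equiv.swap_apply_def]; split_ifs <;> omega
  have e1 : Equiv.swap i (i+1) (i+1+1) = i+1+1 :=
    Equiv.swap_apply_of_ne_of_ne (by omega) (by omega)
  have e2 : Equiv.swap (i+1) (i+1+1) i = i := Equiv.swap_apply_of_ne_of_ne (by omega) (by omega)
  have h1 : w⁻¹ (i + 1) ≠ w⁻¹ i := fun h => by simpa using (w⁻¹).injective h
  have h2 : w⁻¹ (i + 1 + 1) ≠ w⁻¹ (i + 1) := fun h => by simpa using (w⁻¹).injective h
  have h3 : w⁻¹ (i + 1 + 1) ≠ w⁻¹ i := fun h => by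
    have := (w⁻¹).injective h; omega
  have hq : ∀ i, Equiv.swap i (i+1) * Equiv.swap i (i+1) = 1 := fun i => Equiv.swap_mul_self _ _
  have hcw := congrArg (· * w) hc
  simp only [mul_assoc] at hcw
  simp only [Module.End.mul_apply, heckeGen_single, map_add, apply_ite (heckeGen z _), map_zero,
    mul_inv_rev, Equiv.Perm.mul_apply, Equiv.swap_inv, e1, e2, Equiv.swap_apply_left,
    Equiv.swap_apply_right, hcw, mul_assoc, Equiv.swap_mul_self_mul]
  rcases lt_or_gt_of_ne h1 with h1 | h1 <;> rcases lt_or_gt_of_ne h2 with h2 | h2 <;>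
    rcases lt_or_gt_of_ne h3 with h3 | h3 <;> first | omega | skip
  all_goals
    simp only [h1, h2, h3, h1.not_gt, h2.not_gt, h3.not_gt, if_true, if_false, map_zero, map_add,
      heckeGen_single, mul_inv_rev, Equiv.Perm.mul_apply, Equiv.swap_inv, e1, e2,
      Equiv.swap_apply_left, Equiv.swap_apply_right, add_zero, zero_add]
    try abel

theorem heckeGen_right (i j : ℕ) :
    heckeGen z i * heckeGenRight z j = heckeGenRight z j * heckeGen z i := by
  refine Finsupp.lhom_ext fun w c => ?_
  simp only [Module.End.mul_apply, heckeGen_single, heckeGenRight_single, map_add,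
    apply_ite (heckeGen z _), apply_ite (heckeGenRight z _), map_zero,
    mul_inv_rev, Equiv.Perm.mul_apply, Equiv.swap_inv, mul_assoc]
  by_cases hs : Equiv.swap i (i+1) * w = w * Equiv.swap j (j+1)
  · have k1 := fun k => DFunLike.congr_fun hs k
    have k2 : ∀ k, w⁻¹ (Equiv.swap i (i+1) k) = Equiv.swap j (j+1) (w⁻¹ k) := fun k => by
      have := DFunLike.congr_fun (congrArg (·⁻¹) hs) k
      simpa using this
    simp only [Equiv.Perm.mul_apply] at k1
    have a1 := k1 j
    have a2 : w⁻¹ (w (j+1)) = j+1 := by simp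
    have a3 : w⁻¹ (w j) = j := by simp
    have hne : w j ≠ w (j+1) := fun h => by simpa using w.injective h
    rw [Equiv.swap_apply_left, Equiv.swap_apply_def] at a1
    have key : (w j = i ∧ w (j+1) = i+1) ∨ (w j = i+1 ∧ w (j+1) = i) := by
      split_ifs at a1 with u1 u2
      · exact Or.inl ⟨u1, a1.symm⟩
      · exact Or.inr ⟨u2, a1.symm⟩
      · exact absurd a1 hne
    rcases key with ⟨b1, b2⟩ | ⟨b1, b2⟩ <;> rw [b1] at a3 <;> rw [b2] at a2 <;>
      simp [b1, b2, a2, a3, hs] <;> abel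
  · have hd : (w j = i ∧ w (j+1) = i+1) ∨ (w j = i+1 ∧ w (j+1) = i) → False := by
      intro key
      apply hs
      ext k
      have hkj : k = j ∨ k = j+1 ∨ (k ≠ j ∧ k ≠ j+1) := by tauto
      rcases hkj with rfl | rfl | ⟨h1, h2⟩
      · rcases key with ⟨b1, b2⟩ | ⟨b1, b2⟩ <;> simp [b1, b2]
      · rcases key with ⟨b1, b2⟩ | ⟨b1, b2⟩ <;> simp [b1, b2]
      · have c1 : w k ≠ w j := fun h => h1 (w.injective h)
        have c2 : w k ≠ w (j+1) := fun h => h2 (w.injective h)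
        simp only [Equiv.Perm.mul_apply, Equiv.swap_apply_of_ne_of_ne h1 h2]
        rw [Equiv.swap_apply_of_ne_of_ne]
        · rcases key with ⟨b1, b2⟩ | ⟨b1, b2⟩ <;> omega
        · rcases key with ⟨b1, b2⟩ | ⟨b1, b2⟩ <;> omega
    have e1 : (Equiv.swap j (j+1) (w⁻¹ (i+1)) < Equiv.swap j (j+1) (w⁻¹ i)) ↔
        w⁻¹ (i+1) < w⁻¹ i := by
      have p1 : ∀ a b, w⁻¹ a = b ↔ w b = a := fun a b => by
        rw [Equiv.Perm.inv_eq_iff_eq, eq_comm]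
      have := p1 i j; have := p1 (i+1) j; have := p1 i (j+1); have := p1 (i+1) (j+1)
      have hne : w⁻¹ (i+1) ≠ w⁻¹ i := fun h => by simpa using (w⁻¹).injective h
      simp only [Equiv.swap_apply_def]
      split_ifs <;> first | omega | (exfalso; apply hd; omega) | skip
    have e2 : (Equiv.swap i (i+1) (w (j+1)) < Equiv.swap i (i+1) (w j)) ↔
        w (j+1) < w j := by
      have hne : w (j+1) ≠ w j := fun h => by simpa using w.injective h
      simp only [Equiv.swap_apply_def]
      split_ifs <;> first | omega | (exfalso; apply hd; omega) | skip
    simp only [e1, e2]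
    split_ifs <;> simp <;> abel
end Hecke
section JM
variable {R : Type} [CommRing R] (z : R)

/-- The multiplicative Jucys-Murphy elements `J_1 = 1`, `J_{k+1} = g_k J_k g_k`. -/
def jucysMurphy : ℕ → Module.End R (HeckeModule R)
  | 0 => 1
  | 1 => 1
  | k + 2 => heckeGen z (k + 1) * jucysMurphy (k + 1) * heckeGen z (k + 1)

/-- The central element `(J_2 - c) ⋯ (J_n - c)` of the Hecke algebra on `n` strands. -/
def markovElement (c : R) : ℕ → Module.End R (HeckeModule R)
  | 0 => 1
  | 1 => 1
  | n + 2 => markovElement c (n + 1) * (jucysMurphy z (n + 2) + algebraMap R _ (-c))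

/-- The canonical trace of the Hecke algebra: the coefficient of `T_1`. -/
def heckeTrace (X : Module.End R (HeckeModule R)) : R :=
  X (Finsupp.single 1 1) 1

/-- The Hecke algebra on `n` strands, generated by `g_1, …, g_{n-1}`. -/
def heckeSub (n : ℕ) : Subalgebra R (Module.End R (HeckeModule R)) :=
  Algebra.adjoin R {X | ∃ i, 1 ≤ i ∧ i < n ∧ X = heckeGen z i}

theorem heckeGen_mem {n i : ℕ} (h1 : 1 ≤ i) (h2 : i < n) : heckeGen z i ∈ heckeSub z n :=
  Algebra.subset_adjoin ⟨i, h1, h2, rfl⟩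

theorem heckeSub_mono {m n : ℕ} (h : m ≤ n) : heckeSub z m ≤ heckeSub z n :=
  Algebra.adjoin_mono fun _ ⟨i, h1, h2, e⟩ => ⟨i, h1, h2.trans_le h, e⟩

theorem heckeSub_commute {n : ℕ} {Y : Module.End R (HeckeModule R)}
    (h : ∀ i, 1 ≤ i → i < n → Commute (heckeGen z i) Y) {X} (hX : X ∈ heckeSub z n) :
    Commute X Y := by
  induction hX using Algebra.adjoin_induction with
  | mem x hx => obtain ⟨i, h1, h2, rfl⟩ := hx; exact h i h1 h2
  | algebraMap r => exact Algebra.commutes r Y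
  | add x y _ _ hx hy => exact hx.add_left hy
  | mul x y _ _ hx hy => exact hx.mul_left hy

theorem jm_mem (k : ℕ) : jucysMurphy z k ∈ heckeSub z k := by
  induction k using jucysMurphy.induct with
  | case1 => exact one_mem _
  | case2 => exact one_mem _
  | case3 k ih =>
    have hg := heckeGen_mem z (n := k + 2) (i := k + 1) (by omega) (by omega)
    exact mul_mem (mul_mem hg (heckeSub_mono z (by omega) ih)) hg

theorem markov_mem (c : R) (n : ℕ) : markovElement z c n ∈ heckeSub z n := by
  induction n using jucysMurphy.induct with
  | case1 => exact one_mem _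
  | case2 => exact one_mem _
  | case3 k ih =>
    exact mul_mem (heckeSub_mono z (by omega) ih)
      (add_mem (jm_mem z _) (Subalgebra.algebraMap_mem _ _))

theorem far_comm {i j : ℕ} (h : i + 2 ≤ j ∨ j + 2 ≤ i) :
    Commute (heckeGen z i) (heckeGen z j) := by
  rcases h with h | h
  · exact heckeGen_far z i j h
  · exact (heckeGen_far z j i h).symm

theorem heckeSub_far {n i : ℕ} (h : n + 1 ≤ i) {X} (hX : X ∈ heckeSub z n) :
    Commute X (heckeGen z i) :=
  heckeSub_commute z (fun j _ h2 => far_comm z (Or.inl (by omega))) hX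

theorem jm_low (k i : ℕ) (h1 : 1 ≤ i) (h : i + 2 ≤ k) :
    Commute (heckeGen z i) (jucysMurphy z k) := by
  induction k using jucysMurphy.induct with
  | case1 => omega
  | case2 => omega
  | case3 k ih =>
    rcases Nat.lt_or_ge i k with hik | hik
    · have f := far_comm z (i := i) (j := k + 1) (Or.inl (by omega))
      exact (f.mul_right (ih (by omega))).mul_right f
    · obtain ⟨m, rfl⟩ : ∃ m, k = m + 1 := ⟨k - 1, by omega⟩
      obtain rfl : i = m + 1 := by omega
      have hb := heckeGen_braid z (m + 1)
      have hJ : jucysMurphy z (m + 1) * heckeGen z (m + 2) =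
          heckeGen z (m + 2) * jucysMurphy z (m + 1) :=
        heckeSub_far z (by omega) (jm_mem z _)
      show heckeGen z (m + 1) * (heckeGen z (m + 2) * (heckeGen z (m + 1) *
          jucysMurphy z (m + 1) * heckeGen z (m + 1)) * heckeGen z (m + 2)) =
        (heckeGen z (m + 2) * (heckeGen z (m + 1) *
          jucysMurphy z (m + 1) * heckeGen z (m + 1)) * heckeGen z (m + 2)) * heckeGen z (m + 1)
      rw [show m + 1 + 1 = m + 2 from rfl] at hb
      generalize heckeGen z (m + 1) = a at *
      generalize heckeGen z (m + 2) = b at *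
      generalize jucysMurphy z (m + 1) = J at *
      calc a * (b * (a * J * a) * b) = (a * b * a) * J * a * b := by simp only [mul_assoc]
        _ = b * a * (b * J) * a * b := by rw [hb]; simp only [mul_assoc]
        _ = b * a * J * (b * a * b) := by rw [← hJ]; simp only [mul_assoc]
        _ = _ := by rw [← hb]; simp only [mul_assoc]

theorem jm_commute_sub (k : ℕ) {X} (hX : X ∈ heckeSub z k) :
    Commute X (jucysMurphy z (k + 1)) :=
  heckeSub_commute z (fun i h1 h2 => jm_low z _ i h1 (by omega)) hX

theorem jm_pair (k : ℕ) (c : R) : Commute (heckeGen z (k + 1))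
    ((jucysMurphy z (k + 1) + algebraMap R _ c) * (jucysMurphy z (k + 2) + algebraMap R _ c)) := by
  have hq := heckeGen_sq z (k + 1)
  have hc : jucysMurphy z (k + 1) * jucysMurphy z (k + 2) =
      jucysMurphy z (k + 2) * jucysMurphy z (k + 1) := jm_commute_sub z (k + 1) (jm_mem z _)
  have hz := Algebra.commutes z (A := Module.End R (HeckeModule R))
  have hcc := Algebra.commutes c (A := Module.End R (HeckeModule R))
  have hJ : jucysMurphy z (k + 2) =
    heckeGen z (k + 1) * jucysMurphy z (k + 1) * heckeGen z (k + 1) := rfl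
  rw [Commute, SemiconjBy, hJ]
  rw [hJ] at hc
  generalize heckeGen z (k + 1) = g at *
  generalize jucysMurphy z (k + 1) = J at *
  generalize algebraMap R (Module.End R (HeckeModule R)) z = Z at *
  generalize algebraMap R (Module.End R (HeckeModule R)) c = D at *
  have s1 : g * (J * (g * J * g)) = J * (g * J * g) * g := by
    rw [show J * (g * J * g) * g = g * J * g * J * g by rw [hc]]; simp only [mul_assoc]
  have s2 : g * (J + g * J * g) = (J + g * J * g) * g := by
    have l : g * (g * J * g) = Z * (g * J * g) + J * g := by
      rw [show g * (g * J * g) = (g * g) * (J * g) by simp only [mul_assoc], hq]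
      simp only [add_mul, mul_assoc, one_mul]
    have r : (g * J * g) * g = Z * (g * J * g) + g * J := by
      rw [show (g * J * g) * g = (g * J) * (g * g) by simp only [mul_assoc], hq, mul_add,
        ← mul_assoc, ← hz (g * J)]
      simp only [mul_assoc, mul_one]
    rw [mul_add, add_mul, l, r]; abel
  have e : (J + D) * (g * J * g + D) = J * (g * J * g) + D * (J + g * J * g) + D * D := by
    rw [add_mul, mul_add, mul_add, ← hcc J, mul_add]; abel
  have s3 : g * (D * (J + g * J * g)) = (D * (J + g * J * g)) * g := by
    rw [← mul_assoc, ← hcc g, mul_assoc, s2, ← mul_assoc]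
  have s4 : g * (D * D) = D * D * g := by
    rw [← mul_assoc, ← hcc g, mul_assoc, ← hcc g, mul_assoc]
  rw [e, mul_add, mul_add, add_mul, add_mul, s3, s4, s1]

theorem markov_central (c : R) (n i : ℕ) (h1 : 1 ≤ i) (h : i < n) :
    Commute (heckeGen z i) (markovElement z c n) := by
  induction n using jucysMurphy.induct with
  | case1 => omega
  | case2 => omega
  | case3 k ih =>
    rcases Nat.lt_or_ge i (k + 1) with hik | hik
    · exact (ih hik).mul_right ((jm_low z (k + 2) i h1 (by omega)).add_right
        (Algebra.commutes (-c) (heckeGen z i)).symm)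
    · obtain rfl : i = k + 1 := by omega
      rcases k with _ | k
      · have : Commute (heckeGen z 1) (jucysMurphy z 2) := by
          show heckeGen z 1 * (heckeGen z 1 * 1 * heckeGen z 1) =
            heckeGen z 1 * 1 * heckeGen z 1 * heckeGen z 1
          simp only [mul_one, mul_assoc]
        exact (Commute.one_right _).mul_right (this.add_right
          (Algebra.commutes (-c) (heckeGen z 1)).symm)
      · have f := (heckeSub_far z (i := k + 2) (by omega) (markov_mem z c (k + 1))).symm
        have := f.mul_right (jm_pair z (k + 1) (-c))
        rw [← mul_assoc] at this
        exact this

theorem heckeTrace_add (X Y : Module.End R (HeckeModule R)) :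
    heckeTrace (X + Y) = heckeTrace X + heckeTrace Y := rfl

theorem heckeTrace_algebraMap (r : R) (X : Module.End R (HeckeModule R)) :
    heckeTrace (algebraMap R _ r * X) = r * heckeTrace X := rfl

theorem heckeTrace_gen (i : ℕ) (y : HeckeModule R) :
    (heckeGen z i y) 1 = (heckeGenRight z i y) 1 := by
  induction y using Finsupp.induction_linear with
  | zero => simp
  | add x y hx hy => rw [map_add, map_add, Finsupp.add_apply, Finsupp.add_apply, hx, hy]
  | single w c =>
    have e1 : Finsupp.single (Equiv.swap i (i + 1) * w) c 1 =
        Finsupp.single (w * Equiv.swap i (i + 1)) c 1 := by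
      have : Equiv.swap i (i + 1) * w = 1 ↔ w * Equiv.swap i (i + 1) = 1 :=
        mul_eq_one_comm
      classical
      rw [Finsupp.single_apply, Finsupp.single_apply]
      exact if_congr this rfl rfl
    have e2 : (if w⁻¹ (i + 1) < w⁻¹ i then Finsupp.single w (c * z) else 0) 1 =
        (if w (i + 1) < w i then Finsupp.single w (c * z) else 0) 1 := by
      by_cases hw : w = 1
      · subst hw; rw [if_neg (by simp), if_neg (by simp)]
      · split_ifs <;> simp [hw]
    rw [heckeGen_single, heckeGenRight_single, Finsupp.add_apply, Finsupp.add_apply, e1, e2]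

theorem heckeSub_right {n : ℕ} {X} (hX : X ∈ heckeSub z n) (j : ℕ) :
    Commute X (heckeGenRight z j) :=
  heckeSub_commute z (fun i _ _ => heckeGen_right z i j) hX

theorem heckeTrace_comm {n : ℕ} {X Y : Module.End R (HeckeModule R)} (hX : X ∈ heckeSub z n)
    (hY : Y ∈ heckeSub z n) : heckeTrace (X * Y) = heckeTrace (Y * X) := by
  induction hY using Algebra.adjoin_induction generalizing X with
  | mem Y hY =>
    obtain ⟨i, _, _, rfl⟩ := hY
    have h1 : heckeGen z i (Finsupp.single 1 1) = heckeGenRight z i (Finsupp.single 1 1) := by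
      rw [heckeGen_single, heckeGenRight_single]; simp
    have h2 := DFunLike.congr_fun (heckeSub_right z hX i).eq (Finsupp.single 1 1)
    rw [heckeTrace, heckeTrace, Module.End.mul_apply, Module.End.mul_apply, h1, heckeTrace_gen]
    exact congrArg (fun f : HeckeModule R => f 1) h2
  | algebraMap r => rw [Algebra.commutes]
  | add Y Y' _ _ h h' => rw [mul_add, add_mul, heckeTrace_add, heckeTrace_add, h hX, h' hX]
  | mul Y Y' hY hY' h h' =>
    rw [← mul_assoc, h' (mul_mem hX hY), ← mul_assoc, h (mul_mem hY' hX), mul_assoc]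

theorem heckeSub_support {n : ℕ} {X} (hX : X ∈ heckeSub z n) {y : HeckeModule R}
    (hy : y ∈ Finsupp.supported R R {w : Equiv.Perm ℕ | w (n + 1) = n + 1}) :
    X y ∈ Finsupp.supported R R {w : Equiv.Perm ℕ | w (n + 1) = n + 1} := by
  induction hX using Algebra.adjoin_induction generalizing y with
  | mem X hX =>
    obtain ⟨i, _, h2, rfl⟩ := hX
    rw [heckeGen, Finsupp.linearCombination_apply]
    refine Submodule.sum_mem _ fun w hw => Submodule.smul_mem _ _ (Submodule.add_mem _ ?_ ?_)
    · refine Finsupp.single_mem_supported R _ ?_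
      have hw' : w (n + 1) = n + 1 := (Finsupp.mem_supported _ _).1 hy hw
      simp only [Set.mem_ofPred_eq, Equiv.Perm.mul_apply, hw']
      exact Equiv.swap_apply_of_ne_of_ne (by omega) (by omega)
    · split_ifs
      · exact Finsupp.single_mem_supported R _ ((Finsupp.mem_supported _ _).1 hy hw)
      · exact zero_mem _
  | algebraMap r => exact Submodule.smul_mem _ r hy
  | add X X' _ _ h h' => exact add_mem (h hy) (h' hy)
  | mul X X' _ _ h h' => exact h (h' hy)

theorem heckeTrace_top {n : ℕ} {X} (hX : X ∈ heckeSub z n) :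
    heckeTrace (heckeGen z n * X) = 0 := by
  have h := heckeSub_support z hX (y := Finsupp.single 1 1)
    (Finsupp.single_mem_supported R _ (by simp))
  rw [heckeTrace, Module.End.mul_apply, heckeGen, Finsupp.linearCombination_apply, Finsupp.sum,
    Finsupp.finsetSum_apply]
  refine Finset.sum_eq_zero fun w hw => ?_
  have hw' : w (n + 1) = n + 1 := (Finsupp.mem_supported _ _).1 h hw
  have hne : Equiv.swap n (n + 1) * w ≠ 1 := fun he => by
    have := DFunLike.congr_fun he (n + 1)
    simp [hw'] at this
  rw [Finsupp.smul_apply, Finsupp.add_apply, Finsupp.single_eq_of_ne' hne, zero_add]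
  by_cases hw1 : w = 1
  · subst hw1; simp
  · split_ifs
    · rw [Finsupp.single_eq_of_ne' hw1, smul_zero]
    · simp

theorem heckeTrace_mid {n : ℕ} {X Y} (hX : X ∈ heckeSub z n) (hY : Y ∈ heckeSub z n) :
    heckeTrace (X * heckeGen z n * Y) = 0 := by
  rcases Nat.eq_zero_or_pos n with rfl | hn
  · have hX1 := heckeSub_commute z (n := 0) (Y := heckeGen z 0) (fun i _ h => by omega) hX
    rw [hX1.eq, mul_assoc]
    exact heckeTrace_top z (mul_mem hX hY)
  · have hm : ∀ {W}, W ∈ heckeSub z n → W ∈ heckeSub z (n + 1) :=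
      fun h => heckeSub_mono z (Nat.le_succ n) h
    have hg := heckeGen_mem z hn (Nat.lt_succ_self n)
    rw [mul_assoc, heckeTrace_comm z (hm hX) (mul_mem hg (hm hY)), mul_assoc]
    exact heckeTrace_top z (mul_mem hY hX)

/-- The span of `H_n g_n H_n`. -/
def heckeSpan (n : ℕ) : Submodule R (Module.End R (HeckeModule R)) :=
  Submodule.span R {W | ∃ X ∈ heckeSub z n, ∃ Y ∈ heckeSub z n, W = X * heckeGen z n * Y}

theorem jm_span (n : ℕ) : ∃ W ∈ heckeSpan z (n + 1), jucysMurphy z (n + 2) = 1 + W := by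
  have hz : ∀ n, algebraMap R _ z * heckeGen z (n + 1) ∈ heckeSpan z (n + 1) := fun n =>
    Submodule.subset_span ⟨_, Subalgebra.algebraMap_mem _ z, 1, one_mem _, (mul_one _).symm⟩
  induction n with
  | zero =>
    refine ⟨_, hz 0, ?_⟩
    rw [show jucysMurphy z (0 + 2) = heckeGen z 1 * 1 * heckeGen z 1 from rfl, mul_one,
      heckeGen_sq, add_comm]
  | succ n ih =>
    have key : ∀ W ∈ heckeSpan z (n + 1),
        heckeGen z (n + 2) * W * heckeGen z (n + 2) ∈ heckeSpan z (n + 2) := by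
      intro W hW
      induction hW using Submodule.span_induction with
      | mem W hW =>
        obtain ⟨X, hX, Y, hY, rfl⟩ := hW
        have cX := heckeSub_far z (i := n + 2) le_rfl hX
        have cY := heckeSub_far z (i := n + 2) le_rfl hY
        have hb := heckeGen_braid z (n + 1)
        have hg := heckeGen_mem z (n := n + 2) (i := n + 1) (by omega) (by omega)
        have hm : ∀ {W}, W ∈ heckeSub z (n + 1) → W ∈ heckeSub z (n + 2) :=
          fun h => heckeSub_mono z (Nat.le_succ _) h
        refine Submodule.subset_span ⟨X * heckeGen z (n + 1), mul_mem (hm hX) hg,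
          heckeGen z (n + 1) * Y, mul_mem hg (hm hY), ?_⟩
        calc heckeGen z (n + 2) * (X * heckeGen z (n + 1) * Y) * heckeGen z (n + 2)
            = (heckeGen z (n + 2) * X) * heckeGen z (n + 1) * (Y * heckeGen z (n + 2)) := by
              simp only [mul_assoc]
          _ = X * (heckeGen z (n + 1 + 1) * heckeGen z (n + 1) * heckeGen z (n + 1 + 1)) * Y := by
              rw [← cX.eq, cY.eq]; simp only [mul_assoc]
          _ = _ := by rw [← hb]; simp only [mul_assoc]
      | zero => simp
      | add W W' _ _ h h' => rw [mul_add, add_mul]; exact add_mem h h'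
      | smul r W _ h => rw [mul_smul_comm, smul_mul_assoc]; exact Submodule.smul_mem _ _ h
    obtain ⟨W, hW, e⟩ := ih
    refine ⟨_, add_mem (hz (n + 1)) (key W hW), ?_⟩
    rw [show jucysMurphy z (n + 1 + 2) = heckeGen z (n + 2) * jucysMurphy z (n + 2) *
      heckeGen z (n + 2) from rfl, e, mul_add, add_mul, mul_one, heckeGen_sq]
    abel

theorem heckeTrace_jm {n : ℕ} {U} (hU : U ∈ heckeSub z (n + 1)) :
    heckeTrace (U * jucysMurphy z (n + 2)) = heckeTrace U := by
  have key : ∀ W ∈ heckeSpan z (n + 1), heckeTrace (U * W) = 0 := by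
    intro W hW
    induction hW using Submodule.span_induction with
    | mem W hW =>
      obtain ⟨X, hX, Y, hY, rfl⟩ := hW
      rw [← mul_assoc, ← mul_assoc]
      exact heckeTrace_mid z (mul_mem hU hX) hY
    | zero => simp [heckeTrace]
    | add W W' _ _ h h' => rw [mul_add, heckeTrace_add, h, h', add_zero]
    | smul r W _ h =>
      rw [mul_smul_comm]
      show r * heckeTrace (U * W) = 0
      rw [h, mul_zero]
  obtain ⟨W, hW, e⟩ := jm_span z n
  rw [e, mul_add, heckeTrace_add, key W hW, add_zero, mul_one]

theorem heckeTrace_stab (c : R) {n : ℕ} {X} (hX : X ∈ heckeSub z (n + 1)) :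
    heckeTrace (X * markovElement z c (n + 2)) =
      (1 - c) * heckeTrace (X * markovElement z c (n + 1)) := by
  have hM := markov_mem z c (n + 1)
  rw [show markovElement z c (n + 2) = markovElement z c (n + 1) *
    (jucysMurphy z (n + 2) + algebraMap R _ (-c)) from rfl, ← mul_assoc, mul_add,
    heckeTrace_add, heckeTrace_jm z (mul_mem hX hM), ← Algebra.commutes,
    heckeTrace_algebraMap]
  ring

theorem heckeTrace_stab_gen (c : R) {n : ℕ} {X} (hX : X ∈ heckeSub z (n + 1)) :
    heckeTrace (X * heckeGen z (n + 1) * markovElement z c (n + 2)) =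
      z * heckeTrace (X * markovElement z c (n + 1)) := by
  have hM := markov_mem z c (n + 1)
  have hJ := jm_mem z (n + 1)
  have hm : ∀ {W}, W ∈ heckeSub z (n + 1) → W ∈ heckeSub z (n + 2) :=
    fun h => heckeSub_mono z (Nat.le_succ _) h
  have hg := heckeGen_mem z (n := n + 2) (i := n + 1) (by omega) (by omega)
  have e : heckeGen z (n + 1) * jucysMurphy z (n + 2) = algebraMap R _ z * jucysMurphy z (n + 2) +
      jucysMurphy z (n + 1) * heckeGen z (n + 1) := by
    rw [show jucysMurphy z (n + 2) = heckeGen z (n + 1) * jucysMurphy z (n + 1) *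
        heckeGen z (n + 1) from rfl, ← mul_assoc, ← mul_assoc, heckeGen_sq]
    simp only [add_mul, mul_assoc, one_mul]
  have e1 : heckeTrace (X * heckeGen z (n + 1) * markovElement z c (n + 1) *
      jucysMurphy z (n + 2)) = z * heckeTrace (X * markovElement z c (n + 1)) := by
    rw [mul_assoc, (jm_commute_sub z (n + 1) hM).eq, ← mul_assoc,
      heckeTrace_comm z (n := n + 2) (mul_mem (mul_mem (hm hX) hg) (jm_mem z _)) (hm hM),
      mul_assoc, e, mul_add, mul_add, heckeTrace_add, ← mul_assoc X (algebraMap _ _ _),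
      ← Algebra.commutes, mul_assoc (algebraMap _ _ _), ← mul_assoc (markovElement z c _),
      ← Algebra.commutes, mul_assoc (algebraMap _ _ _), heckeTrace_algebraMap, ← mul_assoc,
      heckeTrace_jm z (mul_mem hM hX), heckeTrace_comm z hM hX]
    have : heckeTrace (markovElement z c (n + 1) * (X * (jucysMurphy z (n + 1) *
        heckeGen z (n + 1)))) = 0 := by
      have h := heckeTrace_mid z (mul_mem (mul_mem hM hX) hJ) (one_mem (heckeSub z (n + 1)))
      simpa only [mul_assoc, mul_one] using h
    rw [this, add_zero]
  rw [show markovElement z c (n + 2) = markovElement z c (n + 1) *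
    (jucysMurphy z (n + 2) + algebraMap R _ (-c)) from rfl, ← mul_assoc, mul_add,
    heckeTrace_add, e1, ← Algebra.commutes, heckeTrace_algebraMap,
    heckeTrace_mid z hX hM, mul_zero, add_zero]
end JM

section Group

/-- The relations of the braid group on `n` strands, whose generators `σ_i` are indexed by
`1 ≤ i < n`. -/
def braidRels (n : ℕ) : Set (FreeGroup {i : ℕ // 1 ≤ i ∧ i < n}) :=
  {r | ∃ i j : {i : ℕ // 1 ≤ i ∧ i < n}, i.1 + 2 ≤ j.1 ∧
      r = FreeGroup.of i * FreeGroup.of j * (FreeGroup.of j * FreeGroup.of i)⁻¹} ∪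
  {r | ∃ i j : {i : ℕ // 1 ≤ i ∧ i < n}, i.1 + 1 = j.1 ∧
      r = FreeGroup.of i * FreeGroup.of j * FreeGroup.of i *
        (FreeGroup.of j * FreeGroup.of i * FreeGroup.of j)⁻¹}

/-- The braid group `B_n` (Artin presentation). -/
abbrev BraidGroup (n : ℕ) : Type := PresentedGroup (braidRels n)

/-- The standard generator `σ_i` of `B_n`. -/
def sigma {n : ℕ} (i : ℕ) (h₁ : 1 ≤ i) (h₂ : i < n) : BraidGroup n :=
  PresentedGroup.of ⟨i, h₁, h₂⟩

theorem lift_braidRels {n : ℕ} {G : Type*} [Group G] (f : {i : ℕ // 1 ≤ i ∧ i < n} → G)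
    (far : ∀ i j, i.1 + 2 ≤ j.1 → f i * f j = f j * f i)
    (braid : ∀ i j, i.1 + 1 = j.1 → f i * f j * f i = f j * f i * f j) :
    ∀ r ∈ braidRels n, FreeGroup.lift f r = 1 := by
  rintro r (⟨i, j, h, rfl⟩ | ⟨i, j, h, rfl⟩)
  · simp only [map_mul, map_inv, FreeGroup.lift_apply_of, far i j h, mul_inv_cancel]
  · simp only [map_mul, map_inv, FreeGroup.lift_apply_of, braid i j h, mul_inv_cancel]

theorem sigma_far {n : ℕ} (i j : ℕ) (hi₁ : 1 ≤ i) (hi₂ : i < n) (hj₁ : 1 ≤ j) (hj₂ : j < n)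
    (h : i + 2 ≤ j) :
    sigma i hi₁ hi₂ * sigma j hj₁ hj₂ = sigma j hj₁ hj₂ * sigma i hi₁ hi₂ := by
  have := (PresentedGroup.one_of_mem (rels := braidRels n)
    (Or.inl ⟨⟨i, hi₁, hi₂⟩, ⟨j, hj₁, hj₂⟩, h, rfl⟩))
  rwa [map_mul, map_inv, mul_inv_eq_one, map_mul, map_mul] at this

theorem sigma_braid {n : ℕ} (i j : ℕ) (hi₁ : 1 ≤ i) (hi₂ : i < n) (hj₁ : 1 ≤ j) (hj₂ : j < n)
    (h : i + 1 = j) :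
    sigma i hi₁ hi₂ * sigma j hj₁ hj₂ * sigma i hi₁ hi₂ =
      sigma j hj₁ hj₂ * sigma i hi₁ hi₂ * sigma j hj₁ hj₂ := by
  have := (PresentedGroup.one_of_mem (rels := braidRels n)
    (Or.inr ⟨⟨i, hi₁, hi₂⟩, ⟨j, hj₁, hj₂⟩, h, rfl⟩))
  rwa [map_mul, map_inv, mul_inv_eq_one, map_mul, map_mul, map_mul, map_mul] at this

/-- The exponent sum as a homomorphism `B_n → ℤ`. -/
def writheHom (n : ℕ) : BraidGroup n →* Multiplicative ℤ :=
  PresentedGroup.toGroup (f := fun _ => Multiplicative.ofAdd (1 : ℤ))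
    (lift_braidRels _ (fun _ _ _ => rfl) (fun _ _ _ => rfl))

/-- The inclusion `B_n → B_{n+1}`, `σ_i ↦ σ_i`. -/
def addStrand (n : ℕ) : BraidGroup n →* BraidGroup (n + 1) :=
  PresentedGroup.toGroup
    (f := fun i : {i : ℕ // 1 ≤ i ∧ i < n} => sigma i.1 i.2.1 (Nat.lt_succ_of_lt i.2.2))
    (lift_braidRels _ (fun i j h => sigma_far _ _ _ _ _ _ h)
      (fun i j h => sigma_braid _ _ _ _ _ _ h))

/-- A braid: a number `n ≥ 1` of strands and an element of `B_n`. -/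
structure Braid where
  strands : ℕ
  strands_pos : 1 ≤ strands
  elt : BraidGroup strands

namespace Braid

/-- The writhe (exponent sum) `w` of a braid. -/
def writhe (b : Braid) : ℤ := Multiplicative.toAdd (writheHom b.strands b.elt)

/-- Positive Markov stabilization: `β ∈ B_n` becomes `β σ_n ∈ B_{n+1}`. -/
def posStab (b : Braid) : Braid :=
  ⟨b.strands + 1, Nat.le_add_left 1 _,
    addStrand b.strands b.elt * sigma b.strands b.strands_pos (Nat.lt_succ_self _)⟩

/-- Negative Markov stabilization: `β ∈ B_n` becomes `β σ_n⁻¹ ∈ B_{n+1}`. -/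
def negStab (b : Braid) : Braid :=
  ⟨b.strands + 1, Nat.le_add_left 1 _,
    addStrand b.strands b.elt * (sigma b.strands b.strands_pos (Nat.lt_succ_self _))⁻¹⟩

end Braid

/-- The Markov moves: conjugation and the two stabilizations. -/
inductive MarkovMove : Braid → Braid → Prop
  | conj (n : ℕ) (hn : 1 ≤ n) (α β : BraidGroup n) : MarkovMove ⟨n, hn, β⟩ ⟨n, hn, α * β * α⁻¹⟩
  | pos (b : Braid) : MarkovMove b b.posStab
  | neg (b : Braid) : MarkovMove b b.negStab

/-- Markov equivalence of braids. By the theorems of Alexander and Markov its classes are the isotopy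
classes of (nonempty) oriented links, through the standard closure of braids. -/
def SameLink : Braid → Braid → Prop := Relation.EqvGen MarkovMove

/-- A function of braids is a link invariant if it only depends on the link that the braid closes up
to. -/
def IsLinkInvariant {X : Type*} (f : Braid → X) : Prop :=
  ∀ b c : Braid, SameLink b c → f b = f c

end Group

section Homflypt
open LaurentPolynomial

/-- The variable `v` of `ℤ[z^±1][v^±1]`. -/
def vVar : ℤ[T;T⁻¹][T;T⁻¹] := T 1
/-- The variable `z` of `ℤ[z^±1][v^±1]`. -/
def zVar : ℤ[T;T⁻¹][T;T⁻¹] := C (T 1)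

/-- The generator `g_i` as a unit of the Hecke algebra, with inverse `g_i - z`. -/
def heckeUnit {R : Type} [CommRing R] (z : R) (i : ℕ) : (Module.End R (HeckeModule R))ˣ where
  val := heckeGen z i
  inv := heckeGen z i + algebraMap R _ (-z)
  val_inv := by
    rw [mul_add, heckeGen_sq, ← Algebra.commutes, add_right_comm, ← add_mul, ← map_add,
      add_neg_cancel, map_zero, zero_mul, zero_add]
  inv_val := by
    rw [add_mul, heckeGen_sq, add_right_comm, ← add_mul, ← map_add,
      add_neg_cancel, map_zero, zero_mul, zero_add]

/-- The homomorphism `σ_i ↦ g_i` from `B_n` to the units of the Hecke algebra. -/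
def heckeRep {R : Type} [CommRing R] (z : R) (n : ℕ) :
    BraidGroup n →* (Module.End R (HeckeModule R))ˣ :=
  PresentedGroup.toGroup (f := fun i : {i : ℕ // 1 ≤ i ∧ i < n} => heckeUnit z i.1)
    (lift_braidRels _ (fun i j h => Units.ext (heckeGen_far z _ _ h))
      (fun i j h => Units.ext (by
        have := heckeGen_braid z i.1
        rw [h] at this
        exact this)))

/-- The Homflypt polynomial `P(v, z)` of the closure of a braid, as an element of
`ℤ[z^±1][v^±1]`: the Ocneanu trace of the image of the braid in the Hecke algebra, normalized by the
writhe. The Ocneanu trace is written through the canonical trace `τ` as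
`x ↦ (v z)^(1-n) τ (x (J_2 - v^2) ⋯ (J_n - v^2))`. That this is the polynomial given by the skein
relation is `homflypt_isHomflypt` below. -/
def homflypt (b : Braid) : ℤ[T;T⁻¹][T;T⁻¹] :=
  T (b.writhe - b.strands + 1) * C (T (1 - b.strands)) *
    heckeTrace ((heckeRep zVar b.strands b.elt).val * markovElement zVar (vVar ^ 2) b.strands)

/-- The characteristic properties of the Homflypt polynomial of closed braids: it is a link invariant,
it is `1` on the unknot, and `P_{D_+} = v z P_{D_0} + v^2 P_{D_-}` for all crossings. -/
structure IsHomflypt (P : Braid → ℤ[T;T⁻¹][T;T⁻¹]) : Prop where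
  invariant : IsLinkInvariant P
  unknot : P ⟨1, le_rfl, 1⟩ = 1
  skein : ∀ (n : ℕ) (hn : 1 ≤ n) (β : BraidGroup n) (i : ℕ) (h₁ : 1 ≤ i) (h₂ : i < n),
    P ⟨n, hn, β * sigma i h₁ h₂⟩ =
      vVar * zVar * P ⟨n, hn, β⟩ + vVar ^ 2 * P ⟨n, hn, β * (sigma i h₁ h₂)⁻¹⟩

theorem heckeRep_sigma {R : Type} [CommRing R] (z : R) {n : ℕ} (i : ℕ) (h₁ : 1 ≤ i) (h₂ : i < n) :
    heckeRep z n (sigma i h₁ h₂) = heckeUnit z i :=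
  PresentedGroup.toGroup.of _

theorem heckeRep_addStrand {R : Type} [CommRing R] (z : R) {n : ℕ} (β : BraidGroup n) :
    heckeRep z (n + 1) (addStrand n β) = heckeRep z n β := by
  have : (heckeRep z (n + 1)).comp (addStrand n) = heckeRep z n := by
    refine PresentedGroup.ext fun i => ?_
    rw [MonoidHom.comp_apply]
    erw [PresentedGroup.toGroup.of]
  exact DFunLike.congr_fun this β

theorem writhe_sigma {n : ℕ} (i : ℕ) (h₁ : 1 ≤ i) (h₂ : i < n) :
    writheHom n (sigma i h₁ h₂) = Multiplicative.ofAdd 1 :=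
  PresentedGroup.toGroup.of _

theorem writhe_addStrand {n : ℕ} (β : BraidGroup n) :
    writheHom (n + 1) (addStrand n β) = writheHom n β := by
  have : (writheHom (n + 1)).comp (addStrand n) = writheHom n := by
    refine PresentedGroup.ext fun i => ?_
    rw [MonoidHom.comp_apply]
    erw [PresentedGroup.toGroup.of]
  exact DFunLike.congr_fun this β

theorem heckeRep_mem {R : Type} [CommRing R] (z : R) {n : ℕ} (β : BraidGroup n) :
    (heckeRep z n β : Module.End R (HeckeModule R)) ∈ heckeSub z n := by
  let H : Subgroup (BraidGroup n) :=
    { carrier := {β | ((heckeRep z n β : (Module.End R (HeckeModule R))ˣ) :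
          Module.End R (HeckeModule R)) ∈ heckeSub z n ∧
        ((heckeRep z n β⁻¹ : (Module.End R (HeckeModule R))ˣ) :
          Module.End R (HeckeModule R)) ∈ heckeSub z n}
      mul_mem' := fun {a b} ha hb => by
        refine ⟨?_, ?_⟩
        · rw [map_mul, Units.val_mul]; exact mul_mem ha.1 hb.1
        · rw [mul_inv_rev, map_mul, Units.val_mul]; exact mul_mem hb.2 ha.2
      one_mem' := by simp [one_mem]
      inv_mem' := fun {a} ha => ⟨ha.2, by rw [inv_inv]; exact ha.1⟩ }
  have h : ∀ j : {i : ℕ // 1 ≤ i ∧ i < n}, PresentedGroup.of j ∈ H := by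
    rintro ⟨i, h1, h2⟩
    have e : heckeRep z n (PresentedGroup.of ⟨i, h1, h2⟩) = heckeUnit z i :=
      heckeRep_sigma z i h1 h2
    refine ⟨?_, ?_⟩
    · rw [e]; exact heckeGen_mem z h1 h2
    · rw [map_inv, e]
      exact add_mem (heckeGen_mem z h1 h2) (Subalgebra.algebraMap_mem _ _)
  exact (PresentedGroup.generated_by (braidRels n) H h β).1

theorem laurent_cancel (a b : ℤ) (X : ℤ[T;T⁻¹][T;T⁻¹]) :
    T a * C (T b) * (zVar * X) = T a * C (T (b + 1)) * X := by
  rw [zVar, T_add b 1, map_mul]; ring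

theorem homflypt_mk (n : ℕ) (hn : 1 ≤ n) (β : BraidGroup n) :
    homflypt ⟨n, hn, β⟩ = T (Multiplicative.toAdd (writheHom n β) - n + 1) * C (T (1 - n)) *
      heckeTrace ((heckeRep zVar n β).val * markovElement zVar (vVar ^ 2) n) := rfl

theorem homflypt_pos (b : Braid) : homflypt b = homflypt b.posStab := by
  obtain ⟨n, hn, β⟩ := b
  obtain ⟨n, rfl⟩ : ∃ m, n = m + 1 := ⟨n - 1, by omega⟩
  have h := heckeTrace_stab_gen zVar (vVar ^ 2) (heckeRep_mem zVar β)
  rw [show Braid.posStab ⟨n + 1, hn, β⟩ = ⟨n + 2, Nat.le_add_left 1 _,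
      addStrand (n + 1) β * sigma (n + 1) hn (Nat.lt_succ_self _)⟩ from rfl,
    homflypt_mk, homflypt_mk, map_mul (writheHom _), map_mul (heckeRep _ _), heckeRep_addStrand,
    heckeRep_sigma, Units.val_mul, writhe_addStrand, writhe_sigma, toAdd_mul, toAdd_ofAdd]
  erw [h]
  rw [laurent_cancel]
  congr 3 <;> push_cast <;> congr 1 <;> ring

theorem homflypt_neg (b : Braid) : homflypt b = homflypt b.negStab := by
  obtain ⟨n, hn, β⟩ := b
  obtain ⟨n, rfl⟩ : ∃ m, n = m + 1 := ⟨n - 1, by omega⟩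
  have h := heckeTrace_stab_gen zVar (vVar ^ 2) (heckeRep_mem zVar β)
  have h' := heckeTrace_stab zVar (vVar ^ 2) (heckeRep_mem zVar β)
  have h3 : heckeTrace ((heckeRep zVar (n + 1) β : Module.End _ (HeckeModule _)) *
      (heckeUnit zVar (n + 1))⁻¹.val * markovElement zVar (vVar ^ 2) (n + 2)) =
      zVar * (T 2 * heckeTrace ((heckeRep zVar (n + 1) β : Module.End _ (HeckeModule _)) *
        markovElement zVar (vVar ^ 2) (n + 1))) := by
    rw [show (heckeUnit zVar (n + 1))⁻¹.val = heckeGen zVar (n + 1) + algebraMap _ _ (-zVar) from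
      rfl, mul_add, add_mul, heckeTrace_add, h, ← Algebra.commutes, mul_assoc (algebraMap _ _ _),
      heckeTrace_algebraMap, h', vVar, T_pow]
    norm_num
    ring
  rw [show Braid.negStab ⟨n + 1, hn, β⟩ = ⟨n + 2, Nat.le_add_left 1 _,
      addStrand (n + 1) β * (sigma (n + 1) hn (Nat.lt_succ_self _))⁻¹⟩ from rfl,
    homflypt_mk, homflypt_mk, map_mul (writheHom _), map_mul (heckeRep _ _),
    map_inv (writheHom _), map_inv (heckeRep _ _),
    heckeRep_addStrand, heckeRep_sigma, Units.val_mul, writhe_addStrand, writhe_sigma, toAdd_mul,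
    toAdd_inv, toAdd_ofAdd]
  erw [h3]
  rw [laurent_cancel, ← mul_assoc, mul_right_comm (T _) (C _) (T 2), ← T_add]
  have e1 : Multiplicative.toAdd (writheHom (n + 1) β) + -1 - ((n + 2 : ℕ) : ℤ) + 1 + 2 =
    Multiplicative.toAdd (writheHom (n + 1) β) - ((n + 1 : ℕ) : ℤ) + 1 := by push_cast; ring
  have e2 : 1 - ((n + 2 : ℕ) : ℤ) + 1 = 1 - ((n + 1 : ℕ) : ℤ) := by push_cast; ring
  rw [e1, e2]

theorem homflypt_conj (n : ℕ) (hn : 1 ≤ n) (α β : BraidGroup n) :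
    homflypt ⟨n, hn, β⟩ = homflypt ⟨n, hn, α * β * α⁻¹⟩ := by
  have hw : writheHom n (α * β * α⁻¹) = writheHom n β := by
    rw [map_mul, map_mul, map_inv, mul_inv_cancel_comm]
  have hZ := markov_mem zVar (vVar ^ 2) n
  have hc : ∀ γ : BraidGroup n, Commute (heckeRep zVar n γ : Module.End _ (HeckeModule _))
      (markovElement zVar (vVar ^ 2) n) := fun γ =>
    heckeSub_commute zVar (fun i h1 h2 => markov_central zVar _ n i h1 h2) (heckeRep_mem zVar γ)
  simp only [homflypt, Braid.writhe, hw]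
  congr 1
  rw [map_mul, Units.val_mul, mul_assoc, (hc α⁻¹).eq, ← mul_assoc,
    heckeTrace_comm zVar (mul_mem (heckeRep_mem zVar _) hZ) (heckeRep_mem zVar _), ← mul_assoc,
    ← Units.val_mul, ← map_mul, inv_mul_cancel_left]

theorem homflypt_unknot : homflypt ⟨1, le_rfl, 1⟩ = 1 := by
  have h : heckeTrace (((1 : (Module.End _ (HeckeModule ℤ[T;T⁻¹][T;T⁻¹]))ˣ)).val *
      markovElement zVar (vVar ^ 2) 1) = 1 := by
    rw [Units.val_one, one_mul]
    exact Finsupp.single_eq_same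
  rw [homflypt_mk, map_one (writheHom _), map_one (heckeRep _ _), h, toAdd_one]
  norm_num

theorem homflypt_skein (n : ℕ) (hn : 1 ≤ n) (β : BraidGroup n) (i : ℕ) (h1 : 1 ≤ i) (h2 : i < n) :
    homflypt ⟨n, hn, β * sigma i h1 h2⟩ =
      vVar * zVar * homflypt ⟨n, hn, β⟩ + vVar ^ 2 * homflypt ⟨n, hn, β * (sigma i h1 h2)⁻¹⟩ := by
  have hu : (heckeUnit zVar i).val = algebraMap _ _ zVar + (heckeUnit zVar i)⁻¹.val := by
    show heckeGen _ _ = algebraMap _ _ zVar + (heckeGen _ _ + algebraMap _ _ (-zVar))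
    rw [add_comm, add_assoc, ← map_add, neg_add_cancel, map_zero, add_zero]
  rw [homflypt_mk, homflypt_mk, homflypt_mk, map_mul (writheHom _), map_mul (writheHom _),
    map_mul (heckeRep _ _), map_mul (heckeRep _ _), map_inv (writheHom _), map_inv (heckeRep _ _),
    heckeRep_sigma, writhe_sigma, toAdd_mul, toAdd_mul, toAdd_inv, toAdd_ofAdd, Units.val_mul,
    Units.val_mul, hu, mul_add, add_mul, heckeTrace_add, ← Algebra.commutes, mul_assoc (algebraMap _ _ _),
    heckeTrace_algebraMap]
  have e1 : ∀ a : ℤ, (T (a + 1 - n + 1) : ℤ[T;T⁻¹][T;T⁻¹]) = vVar * T (a - n + 1) := fun a => by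
    rw [vVar, ← T_add]; congr 1; ring
  have e2 : ∀ a : ℤ, (T (a + 1 - n + 1) : ℤ[T;T⁻¹][T;T⁻¹]) = vVar ^ 2 * T (a + -1 - n + 1) :=
    fun a => by rw [vVar, T_pow, ← T_add]; congr 1; push_cast; ring
  generalize heckeTrace ((heckeRep zVar n β).val * markovElement zVar (vVar ^ 2) n) = X
  generalize heckeTrace ((heckeRep zVar n β).val * (heckeUnit zVar i)⁻¹.val *
    markovElement zVar (vVar ^ 2) n) = Y
  have r : ∀ v t d w x : ℤ[T;T⁻¹][T;T⁻¹], v * t * d * (w * x) = v * w * (t * d * x) := by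
    intros; ring
  have r' : ∀ v t d x : ℤ[T;T⁻¹][T;T⁻¹], v * t * d * x = v * (t * d * x) := by
    intros; ring
  rw [mul_add, ← r, ← r', ← e1, ← e2]

/-- The polynomial `homflypt` is the invariant of oriented links with
`P_{D_+} = v z P_{D_0} + v^2 P_{D_-}` and value `1` on the unknot. -/
theorem homflypt_isHomflypt : IsHomflypt homflypt where
  invariant := by
    intro b c h
    induction h with
    | rel b c h =>
      cases h with
      | conj n hn α β => exact homflypt_conj n hn α β
      | pos => exact homflypt_pos b
      | neg => exact homflypt_neg b
    | refl => rfl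
    | symm _ _ _ ih => exact ih.symm
    | trans _ _ _ _ _ ih ih' => exact ih.trans ih'
  unknot := homflypt_unknot
  skein := homflypt_skein

/-- The Laurent coefficient polynomials `h_j` of a braid `β ∈ B_n`, defined by
`P = v^(w-n+1) ∑_{j<n} h_j(z) v^(2j)`. -/
def Braid.laurentCoeff (b : Braid) (j : ℕ) : ℤ[T;T⁻¹] :=
  (homflypt b).coeff (b.writhe - b.strands + 1 + 2 * j)

/-- The Conway polynomial `∇(z) = P(1, z)` of the closure of a braid. -/
def Braid.conway (b : Braid) : ℤ[T;T⁻¹] :=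
  LaurentPolynomial.eval₂ (RingHom.id ℤ[T;T⁻¹]) 1 (homflypt b)

/-- `C_p(z)`: the Conway polynomial of the elementary torus link `K(p, 2)`, the closure of
`σ_1 ^ p ∈ B_2`. -/
def torusConway (p : ℤ) : ℤ[T;T⁻¹] :=
  Braid.conway ⟨2, by norm_num, sigma 1 le_rfl (by norm_num) ^ p⟩

/-- A function of braids depends only on `w - n`. -/
def DependsOnlyOnWritheSubStrands {X : Type*} (f : Braid → X) : Prop :=
  ∃ F : ℤ → X, ∀ b : Braid, f b = F (b.writhe - b.strands)

/-- A function of braids is determined by the family of parameters `p`. -/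
def DeterminedBy {X ι : Type*} {Y : ι → Type*} (f : Braid → X) (p : ∀ i, Braid → Y i) : Prop :=
  ∀ b c : Braid, (∀ i, p i b = p i c) → f b = f c

end Homflypt

end

end BraidLink

open BraidLink LaurentPolynomial

namespace BraidLink

/-! The Ocneanu trace formula confines the Homflypt polynomial to the exponents `w - n + 1 + 2j`
with `0 ≤ j < n`: the generators and Jucys-Murphy elements do not involve `v`, and the Markov
element is a product of `n - 1` factors linear in `v²` (`homflypt_coeff_ne_zero`). Hence the `h_j`
are all the coefficients, and they sum to the Conway polynomial.

Conjugation and positive stabilization preserve both the polynomial and `w - n`, hence every `h_j`,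
so only negative stabilization can destroy the invariance of `Ω`. The test braids are the unknots
obtained by `k` negative stabilizations of the one-strand braid: there `h_j` is `1` for `j = k` and
`0` otherwise, so `Ω` takes the value `A_k`. An invariant `Ω` thus has constant `A`, and is `A_0`
times the Conway polynomial.

If `Ω = F(w - n)`, the braids `σ_1 ^ p` realize every integer as `w - n`, and the skein relation
becomes `F(m + 1) = z F(m) + F(m - 1)`, the recursion of the `C_p`. Since `z` is a unit, a solution
is fixed by its values at `-1` and `-3` (`IsConwayRec.ext`), so `F` is a combination of two shifts
of `C`; the unknots give `A_j = F(-1 - 2j)`.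

The last claim is formal: a function determined by link invariants is a link invariant, and likewise
for functions of `w - n`. -/

/-! ### The range of `v`-exponents in the Homflypt polynomial -/

theorem coeff_T_mul {R : Type*} [CommRing R] (a i : ℤ) (f : R[T;T⁻¹]) :
    (T a * f).coeff i = f.coeff (i - a) := by
  rw [T, AddMonoidAlgebra.coeff_single_mul_eq_mul_coeff (i - a), one_mul]
  intro m _
  omega

theorem coeff_C_mul {R : Type*} [CommRing R] (a : R) (i : ℤ) (f : R[T;T⁻¹]) :
    (C a * f).coeff i = a * f.coeff i := by
  rw [← smul_eq_C_mul]
  rfl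

/-- The polynomials in `v ^ 2` of degree at most `m`. -/
def evenDegreeLE (m : ℕ) : Submodule ℤ[T;T⁻¹] ℤ[T;T⁻¹][T;T⁻¹] where
  carrier := {f | ∀ i, f.coeff i ≠ 0 → ∃ j : ℕ, j ≤ m ∧ i = 2 * j}
  zero_mem' := fun i h => absurd rfl h
  add_mem' := fun {f g} hf hg i h => by
    by_cases hi : f.coeff i = 0
    · refine hg i fun h' => h ?_
      rw [AddMonoidAlgebra.coeff_add, Finsupp.add_apply, hi, h', add_zero]
    · exact hf i hi
  smul_mem' := fun a f hf i h => hf i fun h' => h (by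
    rw [AddMonoidAlgebra.coeff_smul_apply, h', smul_zero])

theorem evenDegreeLE_mono {m n : ℕ} (h : m ≤ n) : evenDegreeLE m ≤ evenDegreeLE n :=
  fun _ hf i hi => let ⟨j, hj, e⟩ := hf i hi; ⟨j, hj.trans h, e⟩

theorem one_mem_evenDegreeLE (m : ℕ) : 1 ∈ evenDegreeLE m := by
  intro i h
  refine ⟨0, Nat.zero_le m, ?_⟩
  by_contra h'
  exact h (Finsupp.single_eq_of_ne (by simpa using h'))

theorem mul_zVar_mem_evenDegreeLE {m : ℕ} {f : ℤ[T;T⁻¹][T;T⁻¹]} (hf : f ∈ evenDegreeLE m) :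
    f * zVar ∈ evenDegreeLE m := by
  rw [mul_comm, zVar, ← smul_eq_C_mul]
  exact Submodule.smul_mem _ _ hf

theorem vVar_sq_mul_mem_evenDegreeLE {m : ℕ} {f : ℤ[T;T⁻¹][T;T⁻¹]} (hf : f ∈ evenDegreeLE m) :
    vVar ^ 2 * f ∈ evenDegreeLE (m + 1) := by
  intro i h
  rw [vVar, T_pow, coeff_T_mul] at h
  obtain ⟨j, hj, e⟩ := hf _ h
  exact ⟨j + 1, by omega, by push_cast at e ⊢; linarith⟩

/-- An operator raises the degree in `v ^ 2` of the coordinates by at most `k`. -/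
def RaisesDegree (k : ℕ) (X : Module.End ℤ[T;T⁻¹][T;T⁻¹] (HeckeModule ℤ[T;T⁻¹][T;T⁻¹])) : Prop :=
  ∀ m y, (∀ w, y w ∈ evenDegreeLE m) → ∀ w, X y w ∈ evenDegreeLE (m + k)

theorem RaisesDegree.one : RaisesDegree 0 1 := fun _ _ hy => hy

theorem RaisesDegree.mul {k l : ℕ} {X Y} (hX : RaisesDegree k X) (hY : RaisesDegree l Y) :
    RaisesDegree (k + l) (X * Y) := fun _ _ hy => by
  rw [add_comm k l, ← add_assoc]
  exact hX _ _ (hY _ _ hy)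

theorem RaisesDegree.add {k : ℕ} {X Y} (hX : RaisesDegree k X) (hY : RaisesDegree k Y) :
    RaisesDegree k (X + Y) := fun m y hy w => add_mem (hX _ _ hy w) (hY _ _ hy w)

theorem RaisesDegree.mono {k l : ℕ} {X} (hX : RaisesDegree k X) (h : k ≤ l) :
    RaisesDegree l X := fun m y hy w => evenDegreeLE_mono (by omega) (hX m y hy w)

theorem raisesDegree_neg_zVar : RaisesDegree 0 (algebraMap _ _ (-zVar)) := fun _ y hy w => by
  have h := neg_mem (mul_zVar_mem_evenDegreeLE (hy w))
  have e : -zVar * y w = -(y w * zVar) := by ring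
  rw [Module.algebraMap_end_apply, Finsupp.smul_apply, smul_eq_mul, e]
  exact h

theorem raisesDegree_neg_vVar_sq : RaisesDegree 1 (algebraMap _ _ (-(vVar ^ 2))) := fun m y hy w => by
  have h := neg_mem (vVar_sq_mul_mem_evenDegreeLE (hy w))
  have e : -(vVar ^ 2) * y w = -(vVar ^ 2 * y w) := by ring
  rw [Module.algebraMap_end_apply, Finsupp.smul_apply, smul_eq_mul, e]
  exact h

/-- In the basis `T_w` the matrix entries of `g_i` are `0`, `1` and `z`, none of which involves `v`.
-/
theorem raisesDegree_heckeGen (i : ℕ) : RaisesDegree 0 (heckeGen zVar i) := fun m y hy u => by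
  rw [heckeGen, Finsupp.linearCombination_apply, Finsupp.sum, Finsupp.finsetSum_apply]
  refine Submodule.sum_mem _ fun w _ => ?_
  rw [Finsupp.smul_apply, Finsupp.add_apply, smul_add]
  refine add_mem ?_ ?_
  · by_cases h : Equiv.swap i (i + 1) * w = u
    · rw [h, Finsupp.single_eq_same, smul_eq_mul, mul_one]
      exact hy w
    · rw [Finsupp.single_eq_of_ne' h, smul_zero]
      exact zero_mem _
  · split_ifs
    · by_cases h : w = u
      · rw [h, Finsupp.single_eq_same]
        exact mul_zVar_mem_evenDegreeLE (hy u)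
      · rw [Finsupp.single_eq_of_ne' h, smul_zero]
        exact zero_mem _
    · rw [Finsupp.zero_apply, smul_zero]
      exact zero_mem _

theorem raisesDegree_jucysMurphy (k : ℕ) : RaisesDegree 0 (jucysMurphy zVar k) := by
  induction k using jucysMurphy.induct with
  | case1 => exact .one
  | case2 => exact .one
  | case3 k ih => exact ((raisesDegree_heckeGen _).mul ih).mul (raisesDegree_heckeGen _)

/-- Each of the `n - 1` factors `J_k - v²` costs one degree in `v²`. For `n = 0` the element is `1`,
in agreement with truncated subtraction. -/
theorem raisesDegree_markovElement (n : ℕ) :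
    RaisesDegree (n - 1) (markovElement zVar (vVar ^ 2) n) := by
  induction n using jucysMurphy.induct with
  | case1 => exact .one
  | case2 => exact .one
  | case3 k ih =>
    exact ih.mul (((raisesDegree_jucysMurphy _).mono (Nat.zero_le 1)).add raisesDegree_neg_vVar_sq)

theorem raisesDegree_heckeRep {n : ℕ} (β : BraidGroup n) :
    RaisesDegree 0 (heckeRep zVar n β).val := by
  -- The bound is also required of `β⁻¹` so that `H` is closed under inversion; on generators this
  -- holds because `g_i⁻¹ = g_i - z`.
  let H : Subgroup (BraidGroup n) :=
    { carrier := {β | RaisesDegree 0 (heckeRep zVar n β).val ∧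
        RaisesDegree 0 (heckeRep zVar n β⁻¹).val}
      mul_mem' := fun {a b} ha hb => by
        refine ⟨?_, ?_⟩
        · rw [map_mul, Units.val_mul]; exact ha.1.mul hb.1
        · rw [mul_inv_rev, map_mul, Units.val_mul]; exact hb.2.mul ha.2
      one_mem' := by
        rw [Set.mem_ofPred_eq, inv_one, map_one]
        exact ⟨.one, .one⟩
      inv_mem' := fun {a} ha => ⟨ha.2, by rw [inv_inv]; exact ha.1⟩ }
  have h : ∀ j : {i : ℕ // 1 ≤ i ∧ i < n}, PresentedGroup.of j ∈ H := by
    rintro ⟨i, h1, h2⟩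
    have e : heckeRep zVar n (PresentedGroup.of ⟨i, h1, h2⟩) = heckeUnit zVar i :=
      heckeRep_sigma zVar i h1 h2
    refine ⟨?_, ?_⟩
    · rw [e]; exact raisesDegree_heckeGen i
    · rw [map_inv, e]
      exact (raisesDegree_heckeGen i).add raisesDegree_neg_zVar
  exact (PresentedGroup.generated_by (braidRels n) H h β).1

theorem heckeTrace_mem_evenDegreeLE {n : ℕ} (β : BraidGroup n) :
    heckeTrace ((heckeRep zVar n β).val * markovElement zVar (vVar ^ 2) n) ∈
      evenDegreeLE (n - 1) := by
  have h := (raisesDegree_heckeRep β).mul (raisesDegree_markovElement n) 0 (Finsupp.single 1 1)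
    (fun w => ?_) 1
  · rw [Nat.zero_add, Nat.zero_add] at h
    exact h
  · by_cases hw : 1 = w
    · rw [hw, Finsupp.single_eq_same]
      exact one_mem_evenDegreeLE 0
    · rw [Finsupp.single_eq_of_ne' hw]
      exact zero_mem _

/-- The Homflypt polynomial of a closed braid only involves `v ^ (w - n + 1 + 2 * j)`, `j < n`. -/
theorem homflypt_coeff_ne_zero {b : Braid} {i : ℤ} (h : (homflypt b).coeff i ≠ 0) :
    ∃ j : ℕ, j < b.strands ∧ i = b.writhe - b.strands + 1 + 2 * j := by
  rw [homflypt, mul_assoc, coeff_T_mul, coeff_C_mul] at h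
  obtain ⟨j, hj, e⟩ := heckeTrace_mem_evenDegreeLE _ _ (right_ne_zero_of_mul h)
  -- At least one strand is needed to turn `j ≤ n - 1`, with truncated subtraction, into `j < n`.
  exact ⟨j, by have := b.strands_pos; omega, by linarith⟩

theorem Braid.laurentCoeff_eq_zero {b : Braid} {j : ℕ} (h : b.strands ≤ j) :
    b.laurentCoeff j = 0 := by
  by_contra h'
  obtain ⟨k, hk, e⟩ := homflypt_coeff_ne_zero h'
  omega

theorem homflypt_eq_sum (b : Braid) : homflypt b =
    ∑ j ∈ Finset.range b.strands,
      C (b.laurentCoeff j) * T (b.writhe - b.strands + 1 + 2 * j) := by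
  refine LaurentPolynomial.ext fun i => ?_
  simp only [AddMonoidAlgebra.coeff_sum, Finsupp.finsetSum_apply, coeff_C_mul, T_apply,
    mul_ite, mul_one, mul_zero]
  by_cases h : ∃ j : ℕ, j < b.strands ∧ i = b.writhe - b.strands + 1 + 2 * j
  · obtain ⟨j, hj, rfl⟩ := h
    rw [Finset.sum_eq_single j, if_pos rfl]
    · rfl
    · intro k _ hk
      rw [if_neg (by omega)]
    · intro h
      exact absurd (Finset.mem_range.2 hj) h
  · rw [Finset.sum_eq_zero]
    · by_contra h'
      exact h (homflypt_coeff_ne_zero h')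
    · intro j hj
      rw [if_neg fun e => h ⟨j, Finset.mem_range.1 hj, e.symm⟩]

theorem Braid.conway_eq_sum (b : Braid) :
    b.conway = ∑ j ∈ Finset.range b.strands, b.laurentCoeff j := by
  rw [Braid.conway, homflypt_eq_sum, map_sum]
  simp

/-! ### Markov moves and the skein relation on the coefficients `h_j` -/

theorem Braid.writhe_posStab (b : Braid) : b.posStab.writhe = b.writhe + 1 := by
  rw [Braid.writhe, Braid.posStab, map_mul, writhe_addStrand, writhe_sigma]
  rfl

theorem Braid.writhe_negStab (b : Braid) : b.negStab.writhe = b.writhe - 1 := by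
  rw [Braid.writhe, Braid.negStab, map_mul, map_inv, writhe_addStrand, writhe_sigma]
  rfl

theorem Braid.strands_posStab (b : Braid) : b.posStab.strands = b.strands + 1 := rfl

theorem Braid.strands_negStab (b : Braid) : b.negStab.strands = b.strands + 1 := rfl

theorem Braid.laurentCoeff_posStab (b : Braid) (j : ℕ) :
    b.posStab.laurentCoeff j = b.laurentCoeff j := by
  rw [laurentCoeff, laurentCoeff, ← homflypt_pos, writhe_posStab, strands_posStab]
  congr 1
  push_cast
  ring

theorem Braid.laurentCoeff_conj {n : ℕ} (hn : 1 ≤ n) (α β : BraidGroup n) (j : ℕ) :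
    laurentCoeff ⟨n, hn, α * β * α⁻¹⟩ j = laurentCoeff ⟨n, hn, β⟩ j := by
  have hw : writhe ⟨n, hn, α * β * α⁻¹⟩ = writhe ⟨n, hn, β⟩ := by
    simp only [writhe]
    rw [map_mul (writheHom n), map_mul (writheHom n), map_inv (writheHom n), mul_inv_cancel_comm]
  rw [laurentCoeff, laurentCoeff, ← homflypt_conj, hw]

/-- The factors `v` and `v²` of the skein relation exactly compensate the changes of writhe in the
base exponent `w - n + 1`, so the index `j` is the same in all three terms. -/
theorem Braid.laurentCoeff_skein {n : ℕ} (hn : 1 ≤ n) (β : BraidGroup n) {i : ℕ} (h₁ : 1 ≤ i)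
    (h₂ : i < n) (j : ℕ) : laurentCoeff ⟨n, hn, β * sigma i h₁ h₂⟩ j =
      T 1 * laurentCoeff ⟨n, hn, β⟩ j + laurentCoeff ⟨n, hn, β * (sigma i h₁ h₂)⁻¹⟩ j := by
  have hw : writhe ⟨n, hn, β * sigma i h₁ h₂⟩ = writhe ⟨n, hn, β⟩ + 1 := by
    simp only [writhe]
    rw [map_mul, writhe_sigma]
    rfl
  have hw' : writhe ⟨n, hn, β * (sigma i h₁ h₂)⁻¹⟩ = writhe ⟨n, hn, β⟩ - 1 := by
    simp only [writhe]
    rw [map_mul, map_inv, writhe_sigma]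
    rfl
  simp only [laurentCoeff]
  rw [homflypt_skein, hw, hw', AddMonoidAlgebra.coeff_add, Finsupp.add_apply, mul_assoc, vVar,
    coeff_T_mul, zVar, coeff_C_mul, T_pow, coeff_T_mul]
  congr 3 <;> push_cast <;> ring

/-! ### Negatively stabilized unknots as test braids -/

/-- The one-strand braid stabilized negatively `k` times; its closure is the unknot. -/
noncomputable def negUnknot : ℕ → Braid
  | 0 => ⟨1, le_rfl, 1⟩
  | k + 1 => (negUnknot k).negStab

theorem strands_negUnknot (k : ℕ) : (negUnknot k).strands = k + 1 := by
  induction k with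
  | zero => rfl
  | succ k ih => rw [negUnknot, Braid.strands_negStab, ih]

theorem writhe_negUnknot (k : ℕ) : (negUnknot k).writhe = -k := by
  induction k with
  | zero =>
    exact congrArg Multiplicative.toAdd (map_one (writheHom 1))
  | succ k ih =>
    rw [negUnknot, Braid.writhe_negStab, ih]
    push_cast
    ring

theorem homflypt_negUnknot (k : ℕ) : homflypt (negUnknot k) = 1 := by
  induction k with
  | zero => exact homflypt_unknot
  | succ k ih => rw [negUnknot, ← homflypt_neg, ih]

/-- The polynomial is `1 = v ^ 0`, while the base exponent is `w - n + 1 = -k - (k + 1) + 1 = -2k`;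
so the only coefficient sits at `j = k`. -/
theorem laurentCoeff_negUnknot (k j : ℕ) :
    (negUnknot k).laurentCoeff j = if j = k then 1 else 0 := by
  rw [Braid.laurentCoeff, homflypt_negUnknot, strands_negUnknot, writhe_negUnknot, ← T_zero, T_apply]
  refine if_congr ?_ rfl rfl
  push_cast
  omega

theorem sum_laurentCoeff_negUnknot (A : ℕ → ℤ[T;T⁻¹]) (k : ℕ) :
    ∑ j ∈ Finset.range (negUnknot k).strands, A j * (negUnknot k).laurentCoeff j = A k := by
  rw [strands_negUnknot]
  simp [laurentCoeff_negUnknot]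

/-! ### Link invariants among the combinations of the `h_j` -/

theorem isLinkInvariant_of_moves {X : Type*} {f : Braid → X}
    (h : ∀ b c, MarkovMove b c → f b = f c) : IsLinkInvariant f := by
  intro b c hbc
  induction hbc with
  | rel b c h' => exact h b c h'
  | refl => rfl
  | symm _ _ _ ih => exact ih.symm
  | trans _ _ _ _ _ ih ih' => exact ih.trans ih'

/-- Linear combinations of the `h_j` are invariant under all Markov moves but possibly the negative
stabilization. -/
theorem isLinkInvariant_iff_negStab {A : ℕ → ℤ[T;T⁻¹]} {Ω : Braid → ℤ[T;T⁻¹]}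
    (hΩ : ∀ b : Braid, ∑ j ∈ Finset.range b.strands, A j * b.laurentCoeff j = Ω b) :
    IsLinkInvariant Ω ↔ ∀ b : Braid, Ω b.negStab = Ω b := by
  refine ⟨fun h b => (h b b.negStab (.rel _ _ (.neg b))).symm, fun h => ?_⟩
  refine isLinkInvariant_of_moves fun b c hbc => ?_
  cases hbc with
  | conj n hn α β =>
    rw [← hΩ, ← hΩ]
    exact Finset.sum_congr rfl fun j _ => by rw [Braid.laurentCoeff_conj]
  | pos =>
    -- The added strand contributes a term with `j = n`, which vanishes by the exponent bound for
    -- the original braid.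
    rw [← hΩ, ← hΩ, Braid.strands_posStab, Finset.sum_range_succ, Braid.laurentCoeff_posStab,
      Braid.laurentCoeff_eq_zero le_rfl, mul_zero, add_zero]
    exact Finset.sum_congr rfl fun j _ => by rw [Braid.laurentCoeff_posStab]
  | neg => exact (h b).symm

theorem eq_of_isLinkInvariant {A : ℕ → ℤ[T;T⁻¹]} {Ω : Braid → ℤ[T;T⁻¹]}
    (hΩ : ∀ b : Braid, ∑ j ∈ Finset.range b.strands, A j * b.laurentCoeff j = Ω b)
    (h : IsLinkInvariant Ω) (j : ℕ) : A j = A 0 := by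
  rw [← sum_laurentCoeff_negUnknot A j, ← sum_laurentCoeff_negUnknot A 0, hΩ, hΩ]
  induction j with
  | zero => rfl
  | succ j ih => rw [← ih, negUnknot, (isLinkInvariant_iff_negStab hΩ).1 h]

theorem eq_mul_conway {A : ℕ → ℤ[T;T⁻¹]} {Ω : Braid → ℤ[T;T⁻¹]}
    (hΩ : ∀ b : Braid, ∑ j ∈ Finset.range b.strands, A j * b.laurentCoeff j = Ω b)
    (h : IsLinkInvariant Ω) (b : Braid) : Ω b = A 0 * b.conway := by
  rw [← hΩ, Braid.conway_eq_sum, Finset.mul_sum]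
  exact Finset.sum_congr rfl fun j _ => by rw [eq_of_isLinkInvariant hΩ h j]

/-! ### The polynomials `C_p` and their recursion -/

/-- The braid `σ_1 ^ p` on two strands. -/
noncomputable def torusBraid (p : ℤ) : Braid := ⟨2, by norm_num, sigma 1 le_rfl (by norm_num) ^ p⟩

theorem writhe_torusBraid (p : ℤ) : (torusBraid p).writhe = p := by
  rw [Braid.writhe, torusBraid, map_zpow, writhe_sigma, toAdd_zpow, toAdd_ofAdd]
  simp

theorem laurentCoeff_torusBraid (p : ℤ) (j : ℕ) : (torusBraid (p + 1)).laurentCoeff j =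
    T 1 * (torusBraid p).laurentCoeff j + (torusBraid (p - 1)).laurentCoeff j := by
  rw [torusBraid, torusBraid, torusBraid, zpow_add_one, zpow_sub_one, Braid.laurentCoeff_skein]

/-- Stated for arbitrary weights because it serves twice: constant weights `1` give the recursion of
the `C_p`, the given `A` that of `F`. -/
theorem sum_laurentCoeff_torusBraid (A : ℕ → ℤ[T;T⁻¹]) (p : ℤ) :
    ∑ j ∈ Finset.range 2, A j * (torusBraid (p + 1)).laurentCoeff j =
      T 1 * ∑ j ∈ Finset.range 2, A j * (torusBraid p).laurentCoeff j +
        ∑ j ∈ Finset.range 2, A j * (torusBraid (p - 1)).laurentCoeff j := by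
  simp only [laurentCoeff_torusBraid, Finset.mul_sum, ← Finset.sum_add_distrib]
  exact Finset.sum_congr rfl fun j _ => by ring

theorem torusConway_add_one (p : ℤ) :
    torusConway (p + 1) = T 1 * torusConway p + torusConway (p - 1) := by
  have h := sum_laurentCoeff_torusBraid (fun _ => 1) p
  simp only [one_mul] at h
  exact (Braid.conway_eq_sum (torusBraid (p + 1))).trans
    (h.trans (by rw [torusConway, torusConway, Braid.conway_eq_sum, Braid.conway_eq_sum]; rfl))

theorem conway_of_homflypt_eq_one {b : Braid} (h : homflypt b = 1) : b.conway = 1 := by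
  rw [Braid.conway, h, map_one]

theorem torusConway_one : torusConway 1 = 1 := by
  refine conway_of_homflypt_eq_one ?_
  rw [zpow_one]
  have h := homflypt_pos ⟨1, le_rfl, 1⟩
  rw [homflypt_unknot, Braid.posStab] at h
  simp only [map_one, one_mul] at h
  exact h.symm

theorem torusConway_neg_one : torusConway (-1) = 1 := by
  refine conway_of_homflypt_eq_one ?_
  rw [zpow_neg_one]
  have h := homflypt_neg ⟨1, le_rfl, 1⟩
  rw [homflypt_unknot, Braid.negStab] at h
  simp only [map_one, one_mul] at h
  exact h.symm

theorem T_neg_one_mul_T_one : (T (-1) * T 1 : ℤ[T;T⁻¹]) = 1 := by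
  rw [← T_add, neg_add_cancel, T_zero]

/-- The recursion at `0` reads `1 = z C_0 + 1`, and `z` is a unit. -/
theorem torusConway_zero : torusConway 0 = 0 := by
  have h := torusConway_add_one 0
  rw [zero_add, zero_sub, torusConway_one, torusConway_neg_one] at h
  linear_combination (-T (-1)) * h - torusConway 0 * T_neg_one_mul_T_one

/-- The recursion satisfied by the `C_p`. -/
def IsConwayRec (F : ℤ → ℤ[T;T⁻¹]) : Prop := ∀ m, F (m + 1) = T 1 * F m + F (m - 1)

theorem isConwayRec_torusConway : IsConwayRec torusConway := torusConway_add_one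

theorem IsConwayRec.shift {F : ℤ → ℤ[T;T⁻¹]} (hF : IsConwayRec F) (a : ℤ) :
    IsConwayRec fun m => F (m + a) := fun m => by
  have h := hF (m + a)
  rwa [show m + a + 1 = m + 1 + a by ring, show m + a - 1 = m - 1 + a by ring] at h

theorem IsConwayRec.combination {F G : ℤ → ℤ[T;T⁻¹]} (hF : IsConwayRec F) (hG : IsConwayRec G)
    (a b : ℤ[T;T⁻¹]) : IsConwayRec fun m => a * F m + b * G m := fun m => by
  linear_combination a * hF m + b * hG m

/-- A pair of consecutive values propagates upwards by the recursion and downwards by `F(m - 1) =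
F(m + 1) - z F(m)`. -/
theorem IsConwayRec.ext_zero_one {F G : ℤ → ℤ[T;T⁻¹]} (hF : IsConwayRec F) (hG : IsConwayRec G)
    (h0 : F 0 = G 0) (h1 : F 1 = G 1) : F = G := by
  have h : ∀ m : ℤ, F m = G m ∧ F (m + 1) = G (m + 1) := by
    intro m
    induction m using Int.induction_on with
    | zero => exact ⟨h0, by simpa using h1⟩
    | succ m ih =>
      refine ⟨ih.2, ?_⟩
      rw [hF, hG, ih.2, add_sub_cancel_right, ih.1]
    | pred m ih =>
      have hf := hF (-m)
      have hg := hG (-m)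
      rw [sub_add_cancel]
      refine ⟨?_, ih.1⟩
      linear_combination hg - hf + ih.2 - T 1 * ih.1
  exact funext fun m => (h m).1

/-- A solution of the recursion is determined by its values at `m - 1` and `m + 1`. -/
theorem IsConwayRec.ext {F G : ℤ → ℤ[T;T⁻¹]} (hF : IsConwayRec F) (hG : IsConwayRec G) (m : ℤ)
    (h₁ : F (m - 1) = G (m - 1)) (h₂ : F (m + 1) = G (m + 1)) : F = G := by
  -- The middle value is `z⁻¹ (F(m + 1) - F(m - 1))`; here `z` must be invertible.
  have h0 : F m = G m := by
    linear_combination T (-1) * (hG m - hF m + h₂ - h₁) + (G m - F m) * T_neg_one_mul_T_one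
  have h := (hF.shift m).ext_zero_one (hG.shift m) (by simpa using h0)
    (by simpa only [add_comm] using h₂)
  funext k
  have := congrFun h (k - m)
  simpa using this

theorem torusConway_two : torusConway 2 = T 1 := by
  have h := torusConway_add_one 1
  rw [torusConway_one, sub_self, torusConway_zero] at h
  simpa using h

theorem torusConway_three : torusConway 3 = T 1 ^ 2 + 1 := by
  have h := torusConway_add_one 2
  norm_num [torusConway_one, torusConway_two] at h
  rw [h, pow_two]

theorem torusConway_neg_two : torusConway (-2) = -T 1 := by
  have h := torusConway_add_one (-1)
  norm_num [torusConway_neg_one, torusConway_zero] at h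
  linear_combination -h

/-- This is `C_{-p} = (-1)^(p + 1) C_p`. The two parities are proved together because the recursion
of order two needs consecutive values; only the odd case is used later. -/
theorem torusConway_neg_even_odd (k : ℤ) : torusConway (-(2 * k)) = -torusConway (2 * k) ∧
    torusConway (-(2 * k + 1)) = torusConway (2 * k + 1) := by
  induction k using Int.induction_on with
  | zero => simp [torusConway_zero, torusConway_one, torusConway_neg_one]
  | succ k ih =>
    obtain ⟨h0, h1⟩ := ih
    have r1 := torusConway_add_one (2 * k + 1)
    have r2 := torusConway_add_one (2 * (k + 1))
    have r3 := torusConway_add_one (-(2 * k + 1))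
    have r4 := torusConway_add_one (-(2 * (k + 1)))
    ring_nf at *
    constructor
    · linear_combination -r3 + r1 + h0 - T 1 * h1
    · linear_combination -r4 - r2 + h1 - T 1 * (-r3 + r1 + h0 - T 1 * h1)
  | pred k ih =>
    obtain ⟨h0, h1⟩ := ih
    have r1 := torusConway_add_one (2 * -k)
    have r2 := torusConway_add_one (2 * (-k - 1) + 1)
    have r3 := torusConway_add_one (-(2 * -k))
    have r4 := torusConway_add_one (-(2 * (-k - 1) + 1))
    ring_nf at *
    constructor
    · linear_combination r4 - r2 + h0 + T 1 * (r3 + r1 + T 1 * h0 + h1)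
    · linear_combination r3 + r1 + T 1 * h0 + h1

theorem torusConway_odd (j : ℤ) : torusConway (2 * j - 1) = torusConway (1 - 2 * j) := by
  have h := (torusConway_neg_even_odd (j - 1)).2
  rw [show 2 * (j - 1) + 1 = 2 * j - 1 by ring, neg_sub] at h
  exact h.symm

/-! ### Functions of `w - n` -/

/-- The braid `σ_1 ^ (m + 2)` has `w - n = m`, so the recursion on two strands holds for `F` on all
of `ℤ`. The unknot with `k` negative stabilizations has `w - n = -1 - 2k`. -/
theorem apply_writhe_sub_strands {A : ℕ → ℤ[T;T⁻¹]} {Ω : Braid → ℤ[T;T⁻¹]}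
    (hΩ : ∀ b : Braid, ∑ j ∈ Finset.range b.strands, A j * b.laurentCoeff j = Ω b)
    {F : ℤ → ℤ[T;T⁻¹]} (hF : ∀ b : Braid, Ω b = F (b.writhe - b.strands)) :
    IsConwayRec F ∧ ∀ j : ℕ, A j = F (-1 - 2 * j) := by
  constructor
  · have e : ∀ p : ℤ, F p = ∑ j ∈ Finset.range 2, A j * (torusBraid (p + 2)).laurentCoeff j := by
      intro p
      have h := hF (torusBraid (p + 2))
      rw [writhe_torusBraid, ← hΩ] at h
      refine Eq.trans ?_ h.symm
      congr 1
      exact (add_sub_cancel_right p 2).symm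
    intro m
    have h := sum_laurentCoeff_torusBraid A (m + 2)
    rw [e, e, e, show m + 1 + 2 = m + 2 + 1 by ring, show m - 1 + 2 = m + 2 - 1 by ring, h]
  · intro j
    rw [← sum_laurentCoeff_negUnknot A j, hΩ, hF, strands_negUnknot, writhe_negUnknot]
    congr 1
    push_cast
    ring

/-- Interpolation at `-1` and `-3`: as `C_0 = 0`, one of the two shifts vanishes at each point, and
the other takes the value `C_2 = z` or `C_{-2} = -z`. Here `T (-1)` is `z⁻¹`. -/
theorem eq_torusConway {F : ℤ → ℤ[T;T⁻¹]} (hF : IsConwayRec F) (m : ℤ) :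
    F m = T (-1) * F (-1) * torusConway (m + 3) - T (-1) * F (-3) * torusConway (m + 1) := by
  refine (congrFun (hF.ext ((isConwayRec_torusConway.shift 3).combination
    (isConwayRec_torusConway.shift 1) (T (-1) * F (-1)) (-(T (-1) * F (-3)))) (-2) ?_ ?_) m).trans
    (by ring)
  · simp only [Int.reduceAdd, Int.reduceSub, Int.reduceNeg, torusConway_zero, torusConway_neg_two]
    linear_combination -F (-3) * T_neg_one_mul_T_one
  · simp only [Int.reduceAdd, Int.reduceNeg, torusConway_zero, torusConway_two]
    linear_combination -F (-1) * T_neg_one_mul_T_one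

theorem exists_eq_torusConway {F : ℤ → ℤ[T;T⁻¹]} (hF : IsConwayRec F) :
    ∃ a₁ a₂ : ℤ[T;T⁻¹], ∀ m, F m = a₁ * torusConway (m + 4) + a₂ * torusConway (m + 2) := by
  -- The values at `-1` and `-3` demand `a₁ (z² + 1) + a₂ = F(-1)` and `a₁ + a₂ = F(-3)`, a system
  -- with the unit determinant `z²`.
  refine ⟨T (-1) ^ 2 * (F (-1) - F (-3)), F (-3) - T (-1) ^ 2 * (F (-1) - F (-3)), fun m => ?_⟩
  refine congrFun (hF.ext ((isConwayRec_torusConway.shift 4).combination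
    (isConwayRec_torusConway.shift 2) _ _) (-2) ?_ ?_) m
  · simp only [Int.reduceAdd, Int.reduceSub, Int.reduceNeg, torusConway_one, torusConway_neg_one]
    ring
  · simp only [Int.reduceAdd, Int.reduceNeg, torusConway_one, torusConway_three]
    linear_combination -(F (-1) - F (-3)) * (T (-1) * T 1 + 1) * T_neg_one_mul_T_one

/-! ### Families of parameters that determine `Ω` -/

theorem DeterminedBy.exists_not_isLinkInvariant {X ι : Type*} {Y : ι → Type*} {f : Braid → X}
    {p : ∀ i, Braid → Y i} (h : DeterminedBy f p) (hf : ¬ IsLinkInvariant f) :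
    ∃ i, ¬ IsLinkInvariant (p i) := by
  by_contra! hp
  exact hf fun b c hbc => h b c fun i => hp i b c hbc

/-- The pairwise form passes directly from the parameters to the function they determine, without
choosing an `F` for each parameter. -/
theorem dependsOnlyOnWritheSubStrands_iff {X : Type*} {f : Braid → X} :
    DependsOnlyOnWritheSubStrands f ↔
      ∀ b c : Braid, b.writhe - b.strands = c.writhe - c.strands → f b = f c := by
  constructor
  · rintro ⟨F, hF⟩ b c h
    rw [hF, hF, h]
  · intro h
    -- A value of `X` is needed only as the immaterial default of the extension from values of `w -
    -- n` to `ℤ`.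
    have : Nonempty X := ⟨f (negUnknot 0)⟩
    exact ⟨Function.extend (fun b : Braid => b.writhe - b.strands) f fun _ => Classical.arbitrary X,
      fun b => (Function.FactorsThrough.extend_apply (fun b c => h b c) _ b).symm⟩

theorem DeterminedBy.exists_not_dependsOnly {X ι : Type*} {Y : ι → Type*} {f : Braid → X}
    {p : ∀ i, Braid → Y i} (h : DeterminedBy f p) (hf : ¬ DependsOnlyOnWritheSubStrands f) :
    ∃ i, ¬ DependsOnlyOnWritheSubStrands (p i) := by
  by_contra! hp
  exact hf (dependsOnlyOnWritheSubStrands_iff.2 fun b c hbc =>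
    h b c fun i => dependsOnlyOnWritheSubStrands_iff.1 (hp i) b c hbc)

end BraidLink

theorem mainTheorem4 (A : ℕ → ℤ[T;T⁻¹]) (Ω : Braid → ℤ[T;T⁻¹])
    (hΩ : ∀ b : Braid, ∑ j ∈ Finset.range b.strands, A j * b.laurentCoeff j = Ω b) :
    -- being a link invariant is the same as invariance under negative Markov stabilization
    (IsLinkInvariant Ω ↔ ∀ b : Braid, Ω b.negStab = Ω b) ∧
    -- (i) link invariants
    (IsLinkInvariant Ω → (∀ j, A j = A 0) ∧ ∀ b : Braid, Ω b = A 0 * b.conway) ∧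
    -- (ii) functions of `w - n`
    (DependsOnlyOnWritheSubStrands Ω →
      (∃ a₁ a₂ : ℤ[T;T⁻¹],
        (∀ j : ℕ, A j = a₁ * torusConway (2 * j - 3) + a₂ * torusConway (2 * j - 1)) ∧
        ∀ b : Braid, Ω b = a₁ * torusConway (4 + b.writhe - b.strands) +
          a₂ * torusConway (2 + b.writhe - b.strands)) ∧
      (∀ j : ℕ, A j = T (-1) * A 0 * torusConway (2 - 2 * j) -
        T (-1) * A 1 * torusConway (-(2 * j))) ∧
      ∀ b : Braid, Ω b = T (-1) * A 0 * torusConway (b.writhe - b.strands + 3) -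
        T (-1) * A 1 * torusConway (b.writhe - b.strands + 1)) ∧
    -- (iii) all others
    (¬ IsLinkInvariant Ω → ¬ DependsOnlyOnWritheSubStrands Ω →
      ∀ (ι : Type*) (Y : ι → Type*) (p : ∀ i, Braid → Y i), DeterminedBy Ω p →
        (∃ i, ¬ IsLinkInvariant (p i)) ∧ ∃ i, ¬ DependsOnlyOnWritheSubStrands (p i)) := by
  refine ⟨isLinkInvariant_iff_negStab hΩ,
    fun h => ⟨eq_of_isLinkInvariant hΩ h, eq_mul_conway hΩ h⟩, ?_,
    fun h₁ h₂ _ _ _ hp => ⟨hp.exists_not_isLinkInvariant h₁, hp.exists_not_dependsOnly h₂⟩⟩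
  rintro ⟨F, hF⟩
  obtain ⟨hr, hA⟩ := apply_writhe_sub_strands hΩ hF
  obtain ⟨a₁, a₂, ha⟩ := exists_eq_torusConway hr
  have hA₀ : A 0 = F (-1) := by simpa using hA 0
  have hA₁ : A 1 = F (-3) := by simpa using hA 1
  refine ⟨⟨a₁, a₂, fun j => ?_, fun b => ?_⟩, fun j => ?_, fun b => ?_⟩
  -- At `m = -1 - 2j` the indices are `3 - 2j` and `1 - 2j`; both are odd, so the symmetry `C_{-p} =
  -- C_p` changes them into `2j - 3` and `2j - 1`.
  · have h := torusConway_odd (j - 1)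
    rw [show (2 * ((j : ℤ) - 1) - 1) = 2 * j - 3 by ring,
      show (1 - 2 * ((j : ℤ) - 1)) = -1 - 2 * j + 4 by ring] at h
    rw [hA, ha, h, torusConway_odd, show (1 - 2 * (j : ℤ)) = -1 - 2 * j + 2 by ring]
  · rw [hF, ha, show b.writhe - b.strands + 4 = 4 + b.writhe - b.strands by ring,
      show b.writhe - b.strands + 2 = 2 + b.writhe - b.strands by ring]
  · rw [hA, hA₀, hA₁, eq_torusConway hr, show (-1 - 2 * (j : ℤ) + 3) = 2 - 2 * j by ring,
      show (-1 - 2 * (j : ℤ) + 1) = -(2 * j) by ring]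
  · rw [hF, hA₀, hA₁, eq_torusConway hr]
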